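/- Let $p\ge 1$ and $q_1,q_2$ be integers with $\gcd(p,q_1,q_2)=1$, let $\omega\in\mathbb{C}$ be a primitive $p$-th root of unity, and let \[ \Phi(x,y)=1-\prod_{j=1}^{p}\bigl(1-x\,\omega^{q_1 j}-y\,\omega^{q_2 j}\bigr)=\sum_{r,s\ge 0}C_{rs}\,x^r y^s . \] Then all coefficients $C_{rs}$ are real. Moreover $C_{rs}\neq 0$ if and only if $1\le r+s\le p$ and $p\mid (rq_1+sq_2)$. For every such pair $(r,s)$, writing $l=(rq_1+sq_2)/p\in\mathbb{Z}$, the coefficient satisfies $C_{rs}>0$ if and only if $\gcd(r,s,l)$ is odd. -/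

import Mathlib

open MvPolynomial

/-- The polynomial `Φ(x, y) = 1 - ∏_{j=1}^{p} (1 - ω^(q₁ j) x - ω^(q₂ j) y)`,
with `x = X 0` and `y = X 1`. -/
noncomputable def Phi (p : ℕ) (q₁ q₂ : ℤ) (ω : ℂ) : MvPolynomial (Fin 2) ℂ :=
  1 - ∏ j ∈ Finset.Icc 1 p,
    (1 - C (ω ^ (q₁ * (j : ℤ))) * X 0 - C (ω ^ (q₂ * (j : ℤ))) * X 1)

/-- The coefficient of `x^r y^s` in `Phi p q₁ q₂ ω`. -/
noncomputable def phiCoeff (p : ℕ) (q₁ q₂ : ℤ) (ω : ℂ) (r s : ℕ) : ℂ :=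
  coeff (Finsupp.single (0 : Fin 2) r + Finsupp.single (1 : Fin 2) s) (Phi p q₁ q₂ ω)

/-! Invariance of Φ under (x, y) ↦ (ω^q₁ x, ω^q₂ y) kills every coefficient with p ∤ rq₁ + sq₂. For
the others put x = v, y = uv, d = gcd(q₂ - q₁, p), p = md and θ = ω^(q₂ - q₁), a primitive m-th root
of unity. Grouping the factors by residues mod m turns the product into ∏ (1 - θ^(ie) (1 + θ^i u)^d
v^d) over i < m (`prod_collapse`). With k = n + 1 = (r + s)/d, the coefficient is therefore, up to
sign, the u^s-coefficient of a sum over k-subsets T of the m-th roots of unity; there are no such T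
when r + s > p.

Rescale the nodes by η with η^m = (-1)^n. The sum becomes the trace of multiplication by a symmetric
function on the space of functions of T. In the basis of alternants with exponents in {0, …, m - 1},
that is, k particles on a circle of m sites, multiplication by an elementary symmetric function has
entries in ℕ (`coeff_nodePoly_mul_alternant`), because the choice of η makes a turn of the circle
cost no sign (`alternant_snoc`). So the trace is a natural number N. It is positive as soon as one
configuration returns to itself along an allowed path, and evenly spaced particles do
(`exists_spaced_path`).

Undoing the rescaling gives the sign (-1)^(n(w + 1)), where mw = s + ke. A congruence argument mod 2
identifies its parity with that of gcd(r, s, l) (`odd_gcd_iff_even_mul`). -/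

/-! ### Cauchy–Binet and compound matrices. -/

/-- The Cauchy–Binet formula, with the minors indexed by order embeddings. -/
theorem Matrix.det_mul_eq_sum_orderEmbedding {R ι : Type*} [CommRing R] [Fintype ι]
    [LinearOrder ι] {k : ℕ} [Fintype (Fin k ↪o ι)]
    (A : Matrix (Fin k) ι R) (B : Matrix ι (Fin k) R) :
    (A * B).det = ∑ T : Fin k ↪o ι, (A.submatrix id T).det * (B.submatrix T id).det := by
  classical
  have h1 : (A * B).det = ∑ f : Fin k → ι, (∏ t, A t (f t)) * (B.submatrix f id).det := by
    have : (A * B) = fun t => ∑ j, A t j • B j := by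
      ext t i
      simp [Matrix.mul_apply, Finset.sum_apply]
    change Matrix.detRowAlternating (A * B) = _
    rw [this]
    have := (Matrix.detRowAlternating (R := R) (n := Fin k)).toMultilinearMap.map_sum
      (fun t (j : ι) => A t j • B j)
    refine this.trans (Finset.sum_congr rfl fun f _ => ?_)
    have h2 := (Matrix.detRowAlternating (R := R) (n := Fin k)).toMultilinearMap.map_smul_univ
      (fun t => A t (f t)) (fun t => B (f t))
    exact h2
  rw [h1]
  symm
  have h3 : ∀ T : Fin k ↪o ι, (A.submatrix id T).det * (B.submatrix T id).det =
      ∑ σ : Equiv.Perm (Fin k), (∏ t, A t (T (σ t))) * (B.submatrix (T ∘ σ) id).det := by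
    intro T
    rw [← Matrix.det_transpose, Matrix.det_apply', Finset.sum_mul]
    refine Finset.sum_congr rfl fun σ _ => ?_
    have := Matrix.det_permute σ (B.submatrix T id)
    rw [Matrix.submatrix_submatrix] at this
    simp only [Function.comp_id] at this
    rw [this]
    simp only [Matrix.transpose_apply, Matrix.submatrix_apply, id]
    ring
  rw [Finset.sum_congr rfl fun T _ => h3 T, ← Finset.sum_product']
  refine Finset.sum_of_injOn (fun x : (Fin k ↪o ι) × Equiv.Perm (Fin k) => (x.1 ∘ x.2 : Fin k → ι))
    ?_ (fun _ _ => by simp) ?_ (fun _ _ => rfl)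
  · rintro ⟨T, σ⟩ - ⟨T', σ'⟩ - h
    have h' : (T ∘ σ : Fin k → ι) = T' ∘ σ' := h
    have hT : T = T' := by
      have hr : Set.range T = Set.range T' := by
        rw [← σ.surjective.range_comp T, h', σ'.surjective.range_comp T']
      exact DFunLike.coe_injective ((StrictMono.range_inj T.strictMono T'.strictMono).1 hr)
    subst hT
    have : σ = σ' := by
      ext t
      exact congrArg _ (T.injective (congrFun h' t))
    rw [this]
  -- An injective choice of rows is its sorted version composed with a permutation, so a choice
  -- outside the image repeats a row.
  · intro f _ hf
    have hni : ¬ Function.Injective f := by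
      intro hinj
      apply hf
      have hsm : StrictMono (f ∘ Tuple.sort f) :=
        (Tuple.monotone_sort f).strictMono_of_injective (hinj.comp (Tuple.sort f).injective)
      refine ⟨(OrderEmbedding.ofStrictMono _ hsm, (Tuple.sort f).symm), by simp, ?_⟩
      funext t
      simp
    rw [Function.not_injective_iff] at hni
    obtain ⟨a, b, hab, hne⟩ := hni
    rw [Matrix.det_zero_of_row_eq hne (by funext; simp [hab]), mul_zero]

/-- If `F * G` is the scalar `c`, then the compound matrices of `F` and `G` multiply to
the scalar `c ^ k`. -/
theorem Matrix.sum_det_submatrix_mul_det_submatrix {R ι : Type*} [CommRing R] [Fintype ι]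
    [LinearOrder ι] {k : ℕ} [Fintype (Fin k ↪o ι)] {F G : Matrix ι ι R} {c : R}
    (h : F * G = c • (1 : Matrix ι ι R)) (I J : Fin k ↪o ι) :
    ∑ T : Fin k ↪o ι, (F.submatrix I T).det * (G.submatrix T J).det =
      if I = J then c ^ k else 0 := by
  have := Matrix.det_mul_eq_sum_orderEmbedding (F.submatrix I id) (G.submatrix id J)
  simp only [Matrix.submatrix_submatrix, Function.comp_id, Function.id_comp] at this
  have h' : F.submatrix I id * G.submatrix id J = (c • (1 : Matrix ι ι R)).submatrix I J := by
    rw [← h]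
    rfl
  rw [← this, h']
  split_ifs with hIJ
  · subst hIJ
    have : (c • (1 : Matrix ι ι R)).submatrix I I = c • 1 := by
      ext i j
      simp [Matrix.one_apply]
    rw [this, Matrix.det_smul, Matrix.det_one, mul_one, Fintype.card_fin]
  · have : ∃ i, ∀ j, I i ≠ J j := by
      by_contra! hcon
      apply hIJ
      choose f hf using hcon
      have hinj : Function.Injective f := fun a b hab => I.injective (by rw [hf, hf, hab])
      have hr : Set.range I = Set.range J := by
        have : (I : Fin k → ι) = J ∘ f := funext hf
        rw [this, (Finite.injective_iff_surjective.1 hinj).range_comp]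
      exact DFunLike.coe_injective ((StrictMono.range_inj I.strictMono J.strictMono).1 hr)
    obtain ⟨i, hi⟩ := this
    exact Matrix.det_eq_zero_of_row_eq_zero i fun j => by simp [hi j]

/-- The generalised Vandermonde determinant with nodes `z (T t)` and exponents `g i`. -/
noncomputable def alternant {m k : ℕ} (z : Fin m → ℂ) (g : Fin k → ℕ) (T : Fin k ↪o Fin m) : ℂ :=
  (Matrix.of fun t i => z (T t) ^ g i).det

/-- Strictly increasing exponents that lie in a window of length less than `m`. -/
def IsWindow (m : ℕ) {n : ℕ} (g : Fin (n + 1) → ℕ) : Prop :=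
  StrictMono g ∧ g (Fin.last n) < g 0 + m

theorem alternant_eq_zero_of_eq {m k : ℕ} (z : Fin m → ℂ) {g : Fin k → ℕ} {i j : Fin k}
    (hij : i ≠ j) (h : g i = g j) : alternant z g = 0 := by
  funext T
  exact Matrix.det_zero_of_column_eq hij fun t => by simp [h]

theorem alternant_add_const {m k : ℕ} (z : Fin m → ℂ) (g : Fin k → ℕ) (e : ℕ)
    (T : Fin k ↪o Fin m) :
    alternant z (fun i => g i + e) T = (∏ t, z (T t) ^ e) * alternant z g T := by
  rw [alternant, alternant, ← Matrix.det_mul_column]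
  congr 1
  ext t i
  simp [pow_add, mul_comm]

/-- Lowering the last exponent by m costs (-1)^n by the node relation, and moving the last column to
the front is an (n + 1)-cycle of sign (-1)^n; the two signs cancel. -/
theorem alternant_snoc {m n : ℕ} {z : Fin m → ℂ} (hz : ∀ i, z i ^ m = (-1) ^ n)
    (f : Fin n → ℕ) (a : ℕ) :
    alternant z (Fin.snoc f (a + m) : Fin (n + 1) → ℕ) =
      alternant z (Fin.cons a f : Fin (n + 1) → ℕ) := by
  funext T
  have h1 : (Matrix.of fun t i => z (T t) ^ (Fin.snoc f (a + m) : Fin (n + 1) → ℕ) i) =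
      Matrix.of fun t i => (if i = Fin.last n then (-1 : ℂ) ^ n else 1) *
        ((Matrix.of fun t i => z (T t) ^ (Fin.cons a f : Fin (n + 1) → ℕ) i).submatrix id
          (finRotate (n + 1))) t i := by
    ext t i
    refine Fin.lastCases ?_ (fun i => ?_) i
    · simp [pow_add, hz, mul_comm]
    · simp [Fin.castSucc_ne_last]
  rw [alternant, alternant, h1, Matrix.det_mul_row, Matrix.det_permute', sign_finRotate]
  simp only [Finset.prod_ite_eq', Finset.mem_univ, if_true, Nat.add_sub_cancel]
  push_cast
  rw [← mul_assoc, ← pow_add, ← two_mul, pow_mul]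
  norm_num

/-- Every window can be rotated into `{0, …, m - 1}` without changing its alternant. -/
theorem IsWindow.exists_orderEmbedding {m n : ℕ} {z : Fin m → ℂ}
    (hz : ∀ i, z i ^ m = (-1) ^ n) {g : Fin (n + 1) → ℕ} (hg : IsWindow m g) :
    ∃ J : Fin (n + 1) ↪o Fin m, alternant z g = alternant z (fun i => (J i : ℕ)) := by
  -- Each rotation lowers the sum of the exponents by m > 0.
  induction hS : ∑ i, g i using Nat.strong_induction_on generalizing g with
  | _ S ih =>
    by_cases hl : g (Fin.last n) < m
    · exact ⟨OrderEmbedding.ofStrictMono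
        (fun i => ⟨g i, (hg.1.monotone (Fin.le_last i)).trans_lt hl⟩)
        (fun i j hij => Fin.mk_lt_mk.2 (hg.1 hij)), rfl⟩
    · push Not at hl
      obtain ⟨a, ha⟩ := Nat.exists_eq_add_of_le' hl
      have hgs : g = Fin.snoc (Fin.init g) (a + m) := by
        rw [← ha, Fin.snoc_init_self]
      have hm : 0 < m := by
        have := hg.1.monotone (Fin.zero_le (Fin.last n))
        have := hg.2
        omega
      have hsum : ∑ i, (Fin.cons a (Fin.init g) : Fin (n + 1) → ℕ) i < S := by
        rw [← hS, Fin.sum_univ_succ, Fin.sum_univ_castSucc]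
        simp only [Fin.cons_zero, Fin.cons_succ, Fin.init]
        omega
      have hw : IsWindow m (Fin.cons a (Fin.init g) : Fin (n + 1) → ℕ) := by
        have h2 := hg.2
        refine ⟨?_, ?_⟩
        · intro i j hij
          induction j using Fin.cases with
          | zero => exact absurd hij (Fin.not_lt_zero _)
          | succ j =>
            induction i using Fin.cases with
            | zero =>
              have := hg.1.monotone (Fin.zero_le j.castSucc)
              simp only [Fin.cons_zero, Fin.cons_succ, Fin.init]
              omega
            | succ i =>
              simp only [Fin.cons_succ, Fin.init]
              exact hg.1 (Fin.castSucc_lt_castSucc_iff.2 (Fin.succ_lt_succ_iff.1 hij))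
        · cases n with
          | zero => simpa using hm
          | succ n =>
            rw [← Fin.succ_last]
            simp only [Fin.cons_zero, Fin.cons_succ, Fin.init]
            have := hg.1 (Fin.castSucc_lt_last (Fin.last n))
            omega
      obtain ⟨J, hJ⟩ := ih _ hsum hw rfl
      exact ⟨J, by rw [← hJ, hgs, alternant_snoc hz, ← hgs]⟩

/-! ### The Pieri rule and the cone it preserves. -/

/-- The polynomial `∏ (1 + z (T t) X)`. -/
noncomputable def nodePoly {m k : ℕ} (z : Fin m → ℂ) (T : Fin k ↪o Fin m) : Polynomial ℂ :=
  ∏ t, (1 + Polynomial.C (z (T t)) * Polynomial.X)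

/-- Pieri rule for elementary symmetric functions. Absorbing 1 + zX into the column of the node z
splits each row into its old power and X times the next power; multilinear expansion then sums over
the set of raised exponents. -/
theorem coeff_nodePoly_mul_alternant {m k : ℕ} (z : Fin m → ℂ) (g : Fin k → ℕ) (c : ℕ)
    (T : Fin k ↪o Fin m) :
    (nodePoly z T).coeff c * alternant z g T =
      ∑ s ∈ Finset.powersetCard c (Finset.univ : Finset (Fin k)),
        alternant z (fun i => g i + if i ∈ s then 1 else 0) T := by
  classical
  have h0 : ∀ h : Fin k → ℕ, Polynomial.C (alternant z h T) =
      (Matrix.of fun i t => Polynomial.C (z (T t)) ^ h i).det := by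
    intro h
    rw [alternant, RingHom.map_det, ← Matrix.det_transpose]
    congr 1
    ext i t
    simp
  have h1 : nodePoly z T * Polynomial.C (alternant z g T) =
      ∑ s : Finset (Fin k), Polynomial.X ^ s.card *
        Polynomial.C (alternant z (fun i => g i + if i ∈ s then 1 else 0) T) := by
    rw [h0, nodePoly, ← Matrix.det_mul_row]
    have h2 := (Matrix.detRowAlternating (R := Polynomial ℂ) (n := Fin k)).map_add_univ
      (fun i t => Polynomial.X * Polynomial.C (z (T t)) ^ (g i + 1))
      (fun i t => Polynomial.C (z (T t)) ^ (g i))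
    have h3 : (Matrix.of fun i j => (1 + Polynomial.C (z (T j)) * Polynomial.X) *
        (Matrix.of fun i t => Polynomial.C (z (T t)) ^ g i) i j) =
        ((fun i t => Polynomial.X * Polynomial.C (z (T t)) ^ (g i + 1)) +
      (fun i t => Polynomial.C (z (T t)) ^ (g i)) : Fin k → Fin k → Polynomial ℂ) := by
      refine funext₂ fun i j => ?_
      simp only [Matrix.of_apply, Pi.add_apply]
      ring
    rw [h3]
    refine h2.trans (Finset.sum_congr rfl fun s _ => ?_)
    rw [h0]
    have h4 : (Polynomial.X : Polynomial ℂ) ^ s.card =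
        ∏ i : Fin k, if i ∈ s then Polynomial.X else 1 := by
      simp
    rw [h4, ← Matrix.det_mul_column]
    change Matrix.det _ = _
    congr 1
    refine funext₂ fun i j => ?_
    by_cases hi : i ∈ s <;> simp [Finset.piecewise, hi]
  have h5 := congrArg (fun P => Polynomial.coeff P c) h1
  simp only [Polynomial.coeff_mul_C, Polynomial.finsetSum_coeff, Polynomial.coeff_X_pow] at h5
  rw [h5, Finset.powersetCard_eq_filter, Finset.sum_filter, Finset.powerset_univ]
  refine Finset.sum_congr rfl fun s _ => ?_
  by_cases hc : s.card = c
  · simp [hc]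
  · simp [hc, Ne.symm hc]

/-- Moves by at most one site preserve the order unless two particles collide, and then two columns
agree. The window can only fail when the last particle reaches the first one's site a full turn
later, which `alternant_snoc` turns into a collision as well. -/
theorem IsWindow.alternant_move {m n : ℕ} {z : Fin m → ℂ}
    (hz : ∀ i, z i ^ m = (-1) ^ n) {g : Fin (n + 1) → ℕ} (hg : IsWindow m g)
    (s : Finset (Fin (n + 1))) :
    alternant z (fun i => g i + if i ∈ s then 1 else 0) = 0 ∨
      IsWindow m (fun i => g i + if i ∈ s then 1 else 0) := by
  set h : Fin (n + 1) → ℕ := fun i => g i + if i ∈ s then 1 else 0 with hh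
  have hle : ∀ i, g i ≤ h i ∧ h i ≤ g i + 1 := fun i => by
    simp only [hh]; split_ifs <;> omega
  by_cases hinj : Function.Injective h
  · have hmono : Monotone h := by
      intro i j hij
      rcases hij.eq_or_lt with rfl | hij
      · rfl
      · have := hg.1 hij
        have := hle i
        have := hle j
        omega
    have hsm := hmono.strictMono_of_injective hinj
    by_cases hl : h (Fin.last n) < h 0 + m
    · exact Or.inr ⟨hsm, hl⟩
    · left
      have e1 : h (Fin.last n) = h 0 + m := by
        have := hg.2
        have := hle (Fin.last n)
        have := hle 0
        omega
      rw [← Fin.snoc_init_self h, e1, alternant_snoc hz]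
      cases n with
      | zero =>
        exfalso
        have := hg.2
        change h 0 = h 0 + m at e1
        change g 0 < g 0 + m at this
        omega
      | succ n =>
        exact alternant_eq_zero_of_eq z (i := 0) (j := 1) (by simp) rfl
  · left
    rw [Function.not_injective_iff] at hinj
    obtain ⟨i, j, he, hne⟩ := hinj
    exact alternant_eq_zero_of_eq z hne he

/-- The cone of natural number combinations of the alternants of windows. -/
noncomputable def windowCone (n : ℕ) {m : ℕ} (z : Fin m → ℂ) :
    AddSubmonoid ((Fin (n + 1) ↪o Fin m) → ℂ) :=
  AddSubmonoid.closure {v | ∃ g : Fin (n + 1) → ℕ, IsWindow m g ∧ v = alternant z g}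

theorem IsWindow.alternant_mem {m n : ℕ} {z : Fin m → ℂ} {g : Fin (n + 1) → ℕ}
    (hg : IsWindow m g) : alternant z g ∈ windowCone n z :=
  AddSubmonoid.subset_closure ⟨g, hg, rfl⟩

theorem IsWindow.alternant_move_mem {m n : ℕ} {z : Fin m → ℂ} {g : Fin (n + 1) → ℕ}
    (hz : ∀ i, z i ^ m = (-1) ^ n) (hg : IsWindow m g) (s : Finset (Fin (n + 1))) :
    alternant z (fun i => g i + if i ∈ s then 1 else 0) ∈ windowCone n z := by
  rcases hg.alternant_move hz s with h | h
  · rw [h]; exact zero_mem _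
  · exact h.alternant_mem

/-- A multiplier that maps alternants of windows into the cone preserves the cone. -/
theorem mul_mem_windowCone {m n : ℕ} {z : Fin m → ℂ} {f : (Fin (n + 1) ↪o Fin m) → ℂ}
    (hf : ∀ g : Fin (n + 1) → ℕ, IsWindow m g → f * alternant z g ∈ windowCone n z)
    {v : (Fin (n + 1) ↪o Fin m) → ℂ} (hv : v ∈ windowCone n z) : f * v ∈ windowCone n z := by
  induction hv using AddSubmonoid.closure_induction with
  | mem v hv =>
    obtain ⟨g, hg, rfl⟩ := hv
    exact hf g hg
  | zero => rw [mul_zero]; exact zero_mem _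
  | add v w _ _ h1 h2 => rw [mul_add]; exact add_mem h1 h2

theorem coeff_nodePoly_mul_mem {m n : ℕ} {z : Fin m → ℂ} (hz : ∀ i, z i ^ m = (-1) ^ n)
    (c : ℕ) {v : (Fin (n + 1) ↪o Fin m) → ℂ} (hv : v ∈ windowCone n z) :
    (fun T => (nodePoly z T).coeff c) * v ∈ windowCone n z := by
  refine mul_mem_windowCone (fun g hg => ?_) hv
  have : (fun T => (nodePoly z T).coeff c) * alternant z g =
      ∑ s ∈ Finset.powersetCard c (Finset.univ : Finset (Fin (n + 1))),
        alternant z (fun i => g i + if i ∈ s then 1 else 0) := by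
    funext T
    rw [Finset.sum_apply, ← coeff_nodePoly_mul_alternant, Pi.mul_apply]
  rw [this]
  exact sum_mem fun s _ => hg.alternant_move_mem hz s

theorem coeff_nodePoly_pow_mul_mem {m n : ℕ} {z : Fin m → ℂ} (hz : ∀ i, z i ^ m = (-1) ^ n)
    (d b : ℕ) {v : (Fin (n + 1) ↪o Fin m) → ℂ} (hv : v ∈ windowCone n z) :
    (fun T => (nodePoly z T ^ d).coeff b) * v ∈ windowCone n z := by
  induction d generalizing b with
  | zero =>
    by_cases hb : b = 0
    · convert hv using 1
      funext T
      simp [hb]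
    · convert zero_mem (windowCone n z) using 1
      funext T
      simp [Polynomial.coeff_one, hb]
  | succ d ih =>
    have : (fun T => (nodePoly z T ^ (d + 1)).coeff b) * v =
        ∑ x ∈ Finset.HasAntidiagonal.antidiagonal b, (fun T => (nodePoly z T).coeff x.2) *
          ((fun T => (nodePoly z T ^ d).coeff x.1) * v) := by
      funext T
      simp only [pow_succ, Polynomial.coeff_mul, Pi.mul_apply, Finset.sum_apply, Finset.sum_mul]
      exact Finset.sum_congr rfl fun x _ => by ring
    rw [this]
    exact sum_mem fun x _ => coeff_nodePoly_mul_mem hz _ (ih _)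

theorem prod_pow_mul_mem {m n : ℕ} {z : Fin m → ℂ} (e : ℕ)
    {v : (Fin (n + 1) ↪o Fin m) → ℂ} (hv : v ∈ windowCone n z) :
    (fun T => ∏ t, z (T t) ^ e) * v ∈ windowCone n z := by
  refine mul_mem_windowCone (fun g hg => ?_) hv
  have : (fun T => ∏ t, z (T t) ^ e) * alternant z g = alternant z (fun i => g i + e) := by
    funext T
    rw [alternant_add_const, Pi.mul_apply]
  rw [this]
  refine IsWindow.alternant_mem ⟨fun i j hij => Nat.add_lt_add_right (hg.1 hij) e, ?_⟩
  have := hg.2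
  change g (Fin.last n) + e < g 0 + e + m
  omega

/-! ### Orthogonality of alternants and the trace. -/

/-- The nodes `η θ ^ i`. -/
noncomputable def rootNodes (m : ℕ) (η θ : ℂ) (i : Fin m) : ℂ := η * θ ^ (i : ℕ)

theorem rootNodes_orthogonality {m : ℕ} {η θ : ℂ} (hη : η ≠ 0) (hθ : IsPrimitiveRoot θ m) :
    (Matrix.of fun a j : Fin m => (rootNodes m η θ j)⁻¹ ^ (a : ℕ)) *
      (Matrix.of fun j a : Fin m => rootNodes m η θ j ^ (a : ℕ)) =
      (m : ℂ) • (1 : Matrix (Fin m) (Fin m) ℂ) := by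
  ext a b
  have hm : 0 < m := a.pos
  have hθ0 : θ ≠ 0 := hθ.ne_zero hm.ne'
  simp only [Matrix.mul_apply, Matrix.of_apply, Matrix.smul_apply, rootNodes]
  have key : ∀ j : Fin m, ((η * θ ^ (j : ℕ))⁻¹ ^ (a : ℕ) * (η * θ ^ (j : ℕ)) ^ (b : ℕ)) =
      (η⁻¹ ^ (a : ℕ) * η ^ (b : ℕ)) * (θ⁻¹ ^ (a : ℕ) * θ ^ (b : ℕ)) ^ (j : ℕ) := by
    intro j
    simp only [mul_pow, mul_inv, inv_pow, ← pow_mul, mul_comm (j : ℕ)]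
    ring
  rw [Finset.sum_congr rfl fun j _ => key j, ← Finset.mul_sum,
    Fin.sum_univ_eq_sum_range (fun j => (θ⁻¹ ^ (a : ℕ) * θ ^ (b : ℕ)) ^ j) m]
  by_cases hab : a = b
  · subst hab
    simp [hη, hθ0]
  · have h1 : θ⁻¹ ^ (a : ℕ) * θ ^ (b : ℕ) ≠ 1 := by
      intro h
      apply hab
      rw [inv_pow, inv_mul_eq_one₀ (pow_ne_zero _ hθ0)] at h
      exact Fin.ext (hθ.pow_inj a.2 b.2 h)
    have h2 : (θ⁻¹ ^ (a : ℕ) * θ ^ (b : ℕ)) ^ m = 1 := by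
      rw [mul_pow, ← pow_mul, ← pow_mul, mul_comm (a : ℕ), mul_comm (b : ℕ), pow_mul, pow_mul,
        inv_pow, hθ.pow_eq_one]
      simp
    rw [geom_sum_eq h1, h2]
    simp [hab]

/-- Orthogonality of the rescaled Fourier matrix passes to its compounds: up to the scale m^k,
alternants in the inverse nodes form the dual basis. -/
theorem sum_alternant_mul_alternant_inv {m k : ℕ} {η θ : ℂ} (hη : η ≠ 0)
    (hθ : IsPrimitiveRoot θ m) (I J : Fin k ↪o Fin m) :
    ∑ T, alternant (rootNodes m η θ) (fun i => I i) T *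
      alternant (rootNodes m η θ)⁻¹ (fun i => J i) T = if I = J then (m : ℂ) ^ k else 0 := by
  have h := Matrix.sum_det_submatrix_mul_det_submatrix (rootNodes_orthogonality hη hθ) J I
  simp only [eq_comm (a := J)] at h
  rw [← h]
  refine Finset.sum_congr rfl fun T _ => ?_
  rw [mul_comm, alternant, ← Matrix.det_transpose]
  rfl

/-- Completeness, dual to orthogonality: a one-sided inverse of a square matrix is two-sided, so the
Fourier matrices may be multiplied in the other order. -/
theorem sum_alternant_mul_alternant_inv' {m k : ℕ} (hm : m ≠ 0) {η θ : ℂ} (hη : η ≠ 0)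
    (hθ : IsPrimitiveRoot θ m) (T : Fin k ↪o Fin m) :
    ∑ J : Fin k ↪o Fin m, alternant (rootNodes m η θ) (fun i => J i) T *
      alternant (rootNodes m η θ)⁻¹ (fun i => J i) T = (m : ℂ) ^ k := by
  have hm' : (m : ℂ) ≠ 0 := Nat.cast_ne_zero.2 hm
  have h0 : (Matrix.of fun j a : Fin m => rootNodes m η θ j ^ (a : ℕ)) *
      (Matrix.of fun a j : Fin m => (rootNodes m η θ j)⁻¹ ^ (a : ℕ)) =
      (m : ℂ) • (1 : Matrix (Fin m) (Fin m) ℂ) := by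
    have h1 : ((m : ℂ)⁻¹ • (Matrix.of fun a j : Fin m => (rootNodes m η θ j)⁻¹ ^ (a : ℕ))) *
        (Matrix.of fun j a : Fin m => rootNodes m η θ j ^ (a : ℕ)) = 1 := by
      rw [Matrix.smul_mul, rootNodes_orthogonality hη hθ, inv_smul_smul₀ hm']
    rw [mul_eq_one_comm, Matrix.mul_smul] at h1
    rw [← h1, smul_inv_smul₀ hm']
  have h := Matrix.sum_det_submatrix_mul_det_submatrix h0 T T
  rw [if_pos rfl] at h
  rw [← h]
  refine Finset.sum_congr rfl fun J _ => ?_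
  congr 1
  rw [alternant, ← Matrix.det_transpose]
  rfl

/-- The pairing of the cone with the dual alternants takes natural number values, up to scale. -/
theorem exists_nat_pairing {m n : ℕ} {η θ : ℂ} (hη : η ≠ 0) (hθ : IsPrimitiveRoot θ m)
    (hηm : η ^ m = (-1) ^ n) {v : (Fin (n + 1) ↪o Fin m) → ℂ}
    (hv : v ∈ windowCone n (rootNodes m η θ)) (J : Fin (n + 1) ↪o Fin m) :
    ∃ N : ℕ, ∑ T, v T * alternant (rootNodes m η θ)⁻¹ (fun i => J i) T =
      (m : ℂ) ^ (n + 1) * N := by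
  have hz : ∀ i, rootNodes m η θ i ^ m = (-1) ^ n := fun i => by
    rw [rootNodes, mul_pow, hηm, ← pow_mul, mul_comm (i : ℕ), pow_mul, hθ.pow_eq_one, one_pow,
      mul_one]
  induction hv using AddSubmonoid.closure_induction with
  | mem v hv =>
    obtain ⟨g, hg, rfl⟩ := hv
    obtain ⟨I, hI⟩ := hg.exists_orderEmbedding hz
    rw [hI, sum_alternant_mul_alternant_inv hη hθ]
    by_cases h : I = J
    · exact ⟨1, by simp [h]⟩
    · exact ⟨0, by simp [h]⟩
  | zero => exact ⟨0, by simp⟩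
  | add v w _ _ h1 h2 =>
    obtain ⟨N1, h1⟩ := h1
    obtain ⟨N2, h2⟩ := h2
    refine ⟨N1 + N2, ?_⟩
    simp only [Pi.add_apply, add_mul, Finset.sum_add_distrib, h1, h2]
    push_cast
    ring

/-- The trace of a multiplier that preserves the cone is a natural number, and it is positive if
the multiplier maps some window to itself plus an element of the cone. -/
theorem exists_nat_sum_multiplier {m n : ℕ} {η θ : ℂ} (hη : η ≠ 0) (hm : m ≠ 0)
    (hθ : IsPrimitiveRoot θ m)
    (hηm : η ^ m = (-1) ^ n) {f : (Fin (n + 1) ↪o Fin m) → ℂ}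
    (hf : ∀ v ∈ windowCone n (rootNodes m η θ), f * v ∈ windowCone n (rootNodes m η θ)) :
    ∃ N : ℕ, ∑ T, f T = N ∧
      ((∃ J : Fin (n + 1) ↪o Fin m, ∃ v ∈ windowCone n (rootNodes m η θ),
        f * alternant (rootNodes m η θ) (fun i => J i) =
          alternant (rootNodes m η θ) (fun i => J i) + v) → N ≠ 0) := by
  have hm' : (m : ℂ) ^ (n + 1) ≠ 0 := pow_ne_zero _ (Nat.cast_ne_zero.2 hm)
  have hwin : ∀ J : Fin (n + 1) ↪o Fin m, IsWindow m (fun i => (J i : ℕ)) := fun J =>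
    ⟨fun i j h => J.strictMono h, (J (Fin.last n)).2.trans_le (Nat.le_add_left _ _)⟩
  choose N hN using fun J : Fin (n + 1) ↪o Fin m =>
    exists_nat_pairing hη hθ hηm (hf _ (hwin J).alternant_mem) J
  refine ⟨∑ J, N J, ?_, ?_⟩
  · apply mul_left_cancel₀ hm'
    push_cast
    -- `N J` is the diagonal matrix entry at `J`; exchanging the sums and using completeness
    -- recovers ∑ f T.
    rw [Finset.mul_sum, Finset.mul_sum, ← Finset.sum_congr rfl fun J _ => hN J, Finset.sum_comm]
    refine Finset.sum_congr rfl fun T _ => ?_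
    rw [← sum_alternant_mul_alternant_inv' hm hη hθ T, Finset.sum_mul]
    refine Finset.sum_congr rfl fun J _ => ?_
    rw [Pi.mul_apply]
    ring
  · rintro ⟨J, v, hv, h⟩ h0
    have hJ := hN J
    obtain ⟨N', hN'⟩ := exists_nat_pairing hη hθ hηm hv J
    rw [h] at hJ
    simp only [Pi.add_apply, add_mul, Finset.sum_add_distrib, hN',
      sum_alternant_mul_alternant_inv hη hθ, if_true] at hJ
    have h1 : (m : ℂ) ^ (n + 1) * (1 + N' : ℕ) = (m : ℂ) ^ (n + 1) * N J := by
      rw [← hJ]; push_cast; ring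
    have h2 : 1 + N' = N J := by exact_mod_cast mul_left_cancel₀ hm' h1
    have h3 := Finset.sum_eq_zero_iff.1 h0 J (Finset.mem_univ J)
    omega

/-! ### A closed path of evenly spaced particles. -/

/-- `⌊(t m d + x) / ((n + 1) d)⌋`: evenly spaced particles at time `x`. -/
def spaced (m n d x : ℕ) (t : Fin (n + 1)) : ℕ := (t * (m * d) + x) / ((n + 1) * d)

theorem isWindow_spaced {m n d : ℕ} (hd : 0 < d) (hnm : n + 1 ≤ m) (x : ℕ) :
    IsWindow m (spaced m n d x) := by
  have hk : 0 < (n + 1) * d := by positivity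
  have hle : (n + 1) * d ≤ m * d := Nat.mul_le_mul_right d hnm
  constructor
  · intro i j hij
    have hij : (i : ℕ) + 1 ≤ j := hij
    simp only [spaced]
    rw [Nat.lt_iff_add_one_le, ← Nat.add_div_right _ hk]
    apply Nat.div_le_div_right
    have : ((i : ℕ) + 1) * (m * d) ≤ j * (m * d) := Nat.mul_le_mul_right _ hij
    rw [add_mul] at this
    omega
  · simp only [spaced, Fin.val_last, Fin.val_zero, zero_mul, zero_add]
    rw [← Nat.add_mul_div_right _ _ hk, Nat.lt_iff_add_one_le, ← Nat.add_div_right _ hk]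
    apply Nat.div_le_div_right
    have : m * ((n + 1) * d) = n * (m * d) + m * d := by ring
    omega

theorem spaced_add_mul {m n d : ℕ} (hd : 0 < d) (x e : ℕ) :
    spaced m n d (x + e * ((n + 1) * d)) = fun t => spaced m n d x t + e := by
  funext t
  rw [spaced, ← add_assoc, Nat.add_mul_div_right _ _ (by positivity), spaced]

/-- After time md each particle stands where its successor stood, and the last one where the first
stood, one turn later. -/
theorem spaced_rotate {m n d : ℕ} (hd : 0 < d) (x : ℕ) :
    ∃ (f : Fin n → ℕ) (a : ℕ), spaced m n d x = Fin.cons a f ∧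
      spaced m n d (x + m * d) = Fin.snoc f (a + m) := by
  refine ⟨fun t => ((t + 1) * (m * d) + x) / ((n + 1) * d), x / ((n + 1) * d), ?_, ?_⟩
  · funext t
    refine Fin.cases ?_ (fun t => ?_) t <;> simp [spaced]
  · funext t
    refine Fin.lastCases ?_ (fun t => ?_) t
    · simp only [spaced, Fin.snoc_last, Fin.val_last]
      rw [← Nat.add_mul_div_right _ _ (by positivity)]
      congr 1
      ring
    · simp only [spaced, Fin.snoc_castSucc, Fin.val_castSucc]
      congr 1
      ring

theorem alternant_spaced_rotate {m n d : ℕ} (hd : 0 < d) {z : Fin m → ℂ}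
    (hz : ∀ i, z i ^ m = (-1) ^ n) (x w : ℕ) :
    alternant z (spaced m n d (x + w * (m * d))) = alternant z (spaced m n d x) := by
  induction w with
  | zero => simp
  | succ w ih =>
    obtain ⟨f, a, h1, h2⟩ := spaced_rotate (m := m) (n := n) hd (x + w * (m * d))
    rw [add_mul, one_mul, ← add_assoc, h2, alternant_snoc hz, ← h1, ih]

theorem sum_spaced_rotate {m n d : ℕ} (hd : 0 < d) (x w : ℕ) :
    ∑ t, spaced m n d (x + w * (m * d)) t = ∑ t, spaced m n d x t + w * m := by
  induction w with
  | zero => simp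
  | succ w ih =>
    obtain ⟨f, a, h1, h2⟩ := spaced_rotate (m := m) (n := n) hd (x + w * (m * d))
    rw [h1, Fin.sum_univ_succ] at ih
    rw [add_mul, one_mul, ← add_assoc, h2, Fin.sum_univ_castSucc]
    simp only [Fin.cons_zero, Fin.cons_succ, Fin.snoc_castSucc, Fin.snoc_last] at ih ⊢
    linarith

/-- A particle advances one site per time (n + 1)d, so within that time it moves at most once: the
motion is a single Pieri step. -/
theorem spaced_add_le {m n d b : ℕ} (hd : 0 < d) (hb : b ≤ (n + 1) * d) (x : ℕ) :
    ∃ s : Finset (Fin (n + 1)), spaced m n d (x + b) =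
      fun t => spaced m n d x t + if t ∈ s then 1 else 0 := by
  refine ⟨Finset.univ.filter fun t => spaced m n d (x + b) t ≠ spaced m n d x t, ?_⟩
  funext t
  have h1 : spaced m n d x t ≤ spaced m n d (x + b) t :=
    Nat.div_le_div_right (by omega)
  have h2 : spaced m n d (x + b) t ≤ spaced m n d x t + 1 := by
    simp only [spaced]
    rw [← Nat.add_div_right _ (show 0 < (n + 1) * d by positivity)]
    exact Nat.div_le_div_right (by omega)
  simp only [Finset.mem_filter, Finset.mem_univ, true_and]
  split_ifs <;> omega

/-- The evenly spaced motion is one term of the iterated Pieri expansion; `v` collects all other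
terms, and `c` is the total displacement. -/
theorem exists_spaced_path {m n d b : ℕ} (hd : 0 < d) (hnm : n + 1 ≤ m) (hb : b ≤ (n + 1) * d)
    {z : Fin m → ℂ} (hz : ∀ i, z i ^ m = (-1) ^ n) (τ : ℕ) :
    ∃ c, ∑ t, spaced m n d (τ * b) t = ∑ t, spaced m n d 0 t + c ∧
      ∃ v ∈ windowCone n z, (fun T => (nodePoly z T ^ τ).coeff c) * alternant z (spaced m n d 0) =
        alternant z (spaced m n d (τ * b)) + v := by
  induction τ with
  | zero => exact ⟨0, by simp, 0, zero_mem _, by funext T; simp⟩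
  | succ τ ih =>
    obtain ⟨c, hc, v, hv, h⟩ := ih
    obtain ⟨s, hs⟩ := spaced_add_le (m := m) hd hb (τ * b)
    have hx : (τ + 1) * b = τ * b + b := by ring
    refine ⟨c + s.card, ?_, ?_⟩
    · rw [hx, hs, Finset.sum_add_distrib, hc]
      simp [add_assoc]
    have hw := isWindow_spaced (n := n) hd hnm (τ * b)
    -- Of the splittings of the degree between the first τ factors and the last one, the term (c,
    -- |s|) carries the path; the others stay in the cone.
    have e1 : (fun T => (nodePoly z T ^ (τ + 1)).coeff (c + s.card)) *
          alternant z (spaced m n d 0) =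
        (fun T => (nodePoly z T).coeff s.card) * (alternant z (spaced m n d (τ * b)) + v) +
        ∑ x ∈ (Finset.HasAntidiagonal.antidiagonal (c + s.card)).erase (c, s.card),
          (fun T => (nodePoly z T).coeff x.2) *
          ((fun T => (nodePoly z T ^ τ).coeff x.1) * alternant z (spaced m n d 0)) := by
      rw [← h]
      have := Finset.add_sum_erase (Finset.HasAntidiagonal.antidiagonal (c + s.card))
        (fun x => (fun T : Fin (n + 1) ↪o Fin m => (nodePoly z T).coeff x.2) *
          ((fun T => (nodePoly z T ^ τ).coeff x.1) * alternant z (spaced m n d 0)))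
        (a := (c, s.card)) (by simp)
      rw [this]
      funext T
      simp only [pow_succ, Polynomial.coeff_mul, Pi.mul_apply, Finset.sum_apply, Finset.sum_mul]
      exact Finset.sum_congr rfl fun x _ => by ring
    have e2 : (fun T => (nodePoly z T).coeff s.card) * alternant z (spaced m n d (τ * b)) =
        alternant z (spaced m n d ((τ + 1) * b)) +
        ∑ s' ∈ (Finset.powersetCard s.card (Finset.univ : Finset (Fin (n + 1)))).erase s,
          alternant z (fun i => spaced m n d (τ * b) i + if i ∈ s' then 1 else 0) := by
      rw [hx, hs]
      have := Finset.add_sum_erase (Finset.powersetCard s.card (Finset.univ : Finset (Fin (n + 1))))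
        (fun s' => alternant z (fun i => spaced m n d (τ * b) i + if i ∈ s' then 1 else 0))
        (a := s) (by simp)
      rw [this]
      funext T
      rw [Finset.sum_apply, ← coeff_nodePoly_mul_alternant, Pi.mul_apply]
    rw [e1, mul_add, e2, add_assoc, add_assoc]
    refine ⟨_, ?_, rfl⟩
    refine add_mem (sum_mem fun s' _ => hw.alternant_move_mem hz s')
      (add_mem (coeff_nodePoly_mul_mem hz _ hv) (sum_mem fun x _ => ?_))
    exact coeff_nodePoly_mul_mem hz _ (coeff_nodePoly_pow_mul_mem hz _ _
      (isWindow_spaced hd hnm 0).alternant_mem)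

/-- The sum over all `(n + 1)`-subsets of the nodes is a natural number, which is positive
when the degrees allow it. -/
theorem exists_nat_sum_coeff {m n d : ℕ} (hd : 0 < d) (hm : m ≠ 0) {η θ : ℂ}
    (hθ : IsPrimitiveRoot θ m) (hηm : η ^ m = (-1) ^ n) (e b : ℕ) :
    ∃ N : ℕ, ∑ T : Fin (n + 1) ↪o Fin m, (∏ t, rootNodes m η θ (T t) ^ e) *
        (nodePoly (rootNodes m η θ) T ^ d).coeff b = N ∧
      (n + 1 ≤ m → b ≤ (n + 1) * d → m ∣ b + (n + 1) * e → N ≠ 0) := by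
  have hη : η ≠ 0 := by
    rintro rfl
    rw [zero_pow hm] at hηm
    exact pow_ne_zero n (neg_ne_zero.2 one_ne_zero) hηm.symm
  have hz : ∀ i, rootNodes m η θ i ^ m = (-1) ^ n := fun i => by
    rw [rootNodes, mul_pow, hηm, ← pow_mul, mul_comm (i : ℕ), pow_mul, hθ.pow_eq_one, one_pow,
      mul_one]
  obtain ⟨N, hN, hpos⟩ := exists_nat_sum_multiplier hη hm hθ hηm
    (f := (fun T => ∏ t, rootNodes m η θ (T t) ^ e) *
      fun T => (nodePoly (rootNodes m η θ) T ^ d).coeff b) (fun v hv => by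
        rw [mul_assoc]
        exact prod_pow_mul_mem e (coeff_nodePoly_pow_mul_mem hz d b hv))
  refine ⟨N, hN, fun hnm hb hdiv => hpos ?_⟩
  obtain ⟨w, hw⟩ := hdiv
  obtain ⟨c, hc, v, hv, h⟩ := exists_spaced_path hd hnm hb hz d
  -- Time db for the d Pieri steps plus time e(n + 1)d for the shift by e equals w rotations, so the
  -- path closes up.
  have hx : d * b + e * ((n + 1) * d) = 0 + w * (m * d) := by
    have : d * (b + (n + 1) * e) = d * (m * w) := by rw [hw]
    linarith
  -- Comparing total displacements: wm for the rotations, c + (n + 1)e for the path and the shift.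
  have hcb : c = b := by
    have h1 := sum_spaced_rotate (m := m) (n := n) hd 0 w
    rw [← hx, spaced_add_mul hd, Finset.sum_add_distrib, hc] at h1
    simp only [Finset.sum_const, Finset.card_univ, Fintype.card_fin, smul_eq_mul] at h1
    have : w * m = m * w := mul_comm _ _
    omega
  subst hcb
  have h2 : (fun T => ∏ t, rootNodes m η θ (T t) ^ e) *
      alternant (rootNodes m η θ) (spaced m n d (d * c)) =
      alternant (rootNodes m η θ) (spaced m n d 0) := by
    rw [← alternant_spaced_rotate hd hz 0 w, ← hx, spaced_add_mul hd]
    funext T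
    rw [alternant_add_const, Pi.mul_apply]
  obtain ⟨J, hJ⟩ := (isWindow_spaced hd hnm 0).exists_orderEmbedding hz
  refine ⟨J, _, prod_pow_mul_mem e hv, ?_⟩
  rw [← hJ, mul_assoc, h, mul_add, h2]

/-! ### Reduction of Φ to a sum over subsets of roots of unity. -/

/-- The substitution `X 0 ↦ v`, `X 1 ↦ u v`, which records the total degree in `v` and the
degree in `X 1` in `u`. -/
noncomputable def degreeHom : MvPolynomial (Fin 2) ℂ →ₐ[ℂ] Polynomial (Polynomial ℂ) :=
  aeval ![Polynomial.X, Polynomial.C Polynomial.X * Polynomial.X]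

theorem coeff_degreeHom (P : MvPolynomial (Fin 2) ℂ) (r s : ℕ) :
    ((degreeHom P).coeff (r + s)).coeff s =
      coeff (Finsupp.single (0 : Fin 2) r + Finsupp.single (1 : Fin 2) s) P := by
  induction P using MvPolynomial.induction_on' with
  | add P Q hP hQ => simp [hP, hQ]
  | monomial m a =>
    have h1 : degreeHom (monomial m a) =
        Polynomial.C (Polynomial.C a * Polynomial.X ^ m 1) * Polynomial.X ^ (m 0 + m 1) := by
      rw [degreeHom, aeval_monomial, Finsupp.prod_fintype _ _ (by simp), Fin.prod_univ_two]
      simp only [Matrix.cons_val_zero, Matrix.cons_val_one, map_mul, map_pow, mul_pow, pow_add]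
      rw [IsScalarTower.algebraMap_apply ℂ (Polynomial ℂ), Polynomial.algebraMap_eq,
        Polynomial.algebraMap_eq]
      ring
    rw [h1, Polynomial.coeff_C_mul_X_pow, coeff_monomial]
    have h2 : m = Finsupp.single (0 : Fin 2) r + Finsupp.single (1 : Fin 2) s ↔
        m 0 = r ∧ m 1 = s := by
      rw [Finsupp.ext_iff, Fin.forall_fin_two]
      simp
    simp only [h2]
    by_cases h : r + s = m 0 + m 1
    · rw [if_pos h, Polynomial.coeff_C_mul_X_pow]
      by_cases h' : s = m 1
      · rw [if_pos h', if_pos (by omega)]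
      · rw [if_neg h', if_neg (by omega)]
    · rw [if_neg h, if_neg (by omega), Polynomial.coeff_zero]

theorem coeff_rescale (a : Fin 2 → ℂ) (P : MvPolynomial (Fin 2) ℂ) (n : Fin 2 →₀ ℕ) :
    coeff n (aeval (fun i => C (a i) * X i : Fin 2 → MvPolynomial (Fin 2) ℂ) P) =
      a 0 ^ n 0 * a 1 ^ n 1 * coeff n P := by
  induction P using MvPolynomial.induction_on' with
  | add P Q hP hQ => rw [map_add, coeff_add, coeff_add, hP, hQ, mul_add]
  | monomial m c =>
    have h1 : aeval (fun i => C (a i) * X i : Fin 2 → MvPolynomial (Fin 2) ℂ) (monomial m c) =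
        monomial m (a 0 ^ m 0 * a 1 ^ m 1 * c) := by
      rw [aeval_monomial, Finsupp.prod_fintype _ _ (by simp), monomial_eq,
        Finsupp.prod_fintype _ _ (by simp), Fin.prod_univ_two, Fin.prod_univ_two, algebraMap_eq]
      simp only [mul_pow, C_mul, C_pow]
      ring
    rw [h1, coeff_monomial, coeff_monomial]
    split_ifs with h
    · rw [h]
    · simp

theorem Finset.prod_Icc_one_eq_prod_range_succ {M : Type*} [CommMonoid M] (p : ℕ) (f : ℕ → M) :
    ∏ j ∈ Finset.Icc 1 p, f j = ∏ j ∈ Finset.range p, f (j + 1) := by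
  have h : Finset.Icc 1 p = Finset.Ico 1 (p + 1) := by
    ext j
    simp only [Finset.mem_Icc, Finset.mem_Ico]
    omega
  rw [h, Finset.prod_Ico_eq_prod_range]
  simp only [Nat.add_sub_cancel, add_comm]

theorem Finset.prod_Icc_one_eq_prod_range {M : Type*} [CommMonoid M] {p : ℕ} {f : ℕ → M}
    (h : f p = f 0) : ∏ j ∈ Finset.Icc 1 p, f j = ∏ j ∈ Finset.range p, f j := by
  rw [Finset.prod_Icc_one_eq_prod_range_succ]
  cases p with
  | zero => rfl
  | succ p => rw [Finset.prod_range_succ, Finset.prod_range_succ', h]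

/-- Scaling x by ω^q₁ and y by ω^q₂ sends the j-th factor of the product to the (j + 1)-st,
cyclically, so it fixes Φ. -/
theorem phiCoeff_mul_zpow {p : ℕ} {q₁ q₂ : ℤ} {ω : ℂ} (hω : ω ^ p = 1) (hω0 : ω ≠ 0) (r s : ℕ) :
    ω ^ ((r : ℤ) * q₁ + (s : ℤ) * q₂) * phiCoeff p q₁ q₂ ω r s = phiCoeff p q₁ q₂ ω r s := by
  have hper : ∀ q : ℤ, ω ^ (q * ((p : ℕ) : ℤ)) = 1 := fun q => by
    rw [mul_comm, zpow_mul, zpow_natCast, hω, one_zpow]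
  have hinv : aeval (fun i => C ((![ω ^ q₁, ω ^ q₂] : Fin 2 → ℂ) i) * X i :
      Fin 2 → MvPolynomial (Fin 2) ℂ) (Phi p q₁ q₂ ω) = Phi p q₁ q₂ ω := by
    have hshift : ∀ (q : ℤ) (j : ℕ), ω ^ (q * (j : ℤ)) * ω ^ q = ω ^ (q * ((j + 1 : ℕ) : ℤ)) := by
      intro q j
      rw [← zpow_add₀ hω0]
      push_cast
      ring_nf
    rw [Phi, map_sub, map_one, map_prod]
    congr 1
    have hsucc : ∀ j : ℕ, aeval (fun i => C ((![ω ^ q₁, ω ^ q₂] : Fin 2 → ℂ) i) * X i :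
        Fin 2 → MvPolynomial (Fin 2) ℂ)
          (1 - C (ω ^ (q₁ * (j : ℤ))) * X 0 - C (ω ^ (q₂ * (j : ℤ))) * X 1) =
        1 - C (ω ^ (q₁ * ((j + 1 : ℕ) : ℤ))) * X 0 - C (ω ^ (q₂ * ((j + 1 : ℕ) : ℤ))) * X 1 := by
      intro j
      rw [← hshift, ← hshift]
      simp only [map_sub, map_one, map_mul, aeval_C, aeval_X, algebraMap_eq, Matrix.cons_val_zero,
        Matrix.cons_val_one]
      ring
    rw [Finset.prod_congr rfl fun j _ => hsucc j, Finset.prod_Icc_one_eq_prod_range,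
      Finset.prod_Icc_one_eq_prod_range_succ]
    rw [← hshift, ← hshift, hper, hper]
    simp
  have h := coeff_rescale ![ω ^ q₁, ω ^ q₂] (Phi p q₁ q₂ ω)
    (Finsupp.single (0 : Fin 2) r + Finsupp.single (1 : Fin 2) s)
  rw [hinv] at h
  rw [phiCoeff]
  conv_rhs => rw [h]
  congr 1
  simp [zpow_add₀ hω0, zpow_mul', zpow_natCast]

theorem prod_one_sub_pow_mul {R : Type*} [CommRing R] [IsDomain R] {β : R} {d : ℕ} (hd : 0 < d)
    (hβ : IsPrimitiveRoot β d) (c : R) :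
    ∏ h ∈ Finset.range d, (1 - β ^ h * c) = 1 - c ^ d := by
  have h1 := hβ.pow_sub_pow_eq_prod_sub_mul 1 c hd
  rw [one_pow] at h1
  rw [h1]
  have : NeZero d := ⟨hd.ne'⟩
  refine Finset.prod_nbij (fun h => β ^ h) (fun h _ => ?_) (fun a ha b hb hab => ?_)
    (fun x hx => ?_) (fun _ _ => rfl)
  · rw [Polynomial.mem_nthRootsFinset hd, ← pow_mul, mul_comm, pow_mul, hβ.pow_eq_one, one_pow]
  · exact hβ.pow_inj (Finset.mem_range.1 ha) (Finset.mem_range.1 hb) hab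
  · obtain ⟨i, hi, rfl⟩ := hβ.eq_pow_of_pow_eq_one
      ((Polynomial.mem_nthRootsFinset hd 1).1 hx)
    exact ⟨i, Finset.mem_coe.2 (Finset.mem_range.2 hi), rfl⟩

theorem Finset.prod_range_mul_eq {M : Type*} [CommMonoid M] (m d : ℕ) (f : ℕ → M) :
    ∏ j ∈ Finset.range (m * d), f j =
      ∏ i ∈ Finset.range m, ∏ h ∈ Finset.range d, f (i + m * h) := by
  rw [Finset.prod_comm]
  induction d with
  | zero => simp
  | succ d ih =>
    rw [Nat.mul_succ, Finset.prod_range_add, ih, Finset.prod_range_succ]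
    simp only [add_comm]

/-- The product over the residues mod `m d` collapses to a product over the residues mod `m`. -/
theorem prod_collapse {m d e : ℕ} (hd : 0 < d) {α θ : ℂ} (hα : IsPrimitiveRoot (α ^ m) d)
    (hθ : θ ^ m = 1) (he : α ^ d = θ ^ e) :
    ∏ j ∈ Finset.range (m * d), (1 - Polynomial.C (Polynomial.C (α ^ j) *
        (1 + Polynomial.C (θ ^ j) * Polynomial.X)) * Polynomial.X) =
      ∏ i : Fin m, (1 - Polynomial.C (Polynomial.C ((θ ^ (i : ℕ)) ^ e) *
        (1 + Polynomial.C (θ ^ (i : ℕ)) * Polynomial.X) ^ d) * Polynomial.X ^ d) := by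
  rw [Finset.prod_range_mul_eq, Fin.prod_univ_eq_prod_range (fun i =>
    (1 - Polynomial.C (Polynomial.C ((θ ^ (i : ℕ)) ^ e) *
        (1 + Polynomial.C (θ ^ (i : ℕ)) * Polynomial.X) ^ d) * Polynomial.X ^ d)) m]
  refine Finset.prod_congr rfl fun i _ => ?_
  have hβ : IsPrimitiveRoot (Polynomial.C (Polynomial.C (α ^ m))) d :=
    (hα.map_of_injective Polynomial.C_injective).map_of_injective Polynomial.C_injective
  have h1 := prod_one_sub_pow_mul hd hβ (Polynomial.C (Polynomial.C (α ^ i) *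
        (1 + Polynomial.C (θ ^ i) * Polynomial.X)) * Polynomial.X)
  have h2 : (θ ^ i) ^ e = (α ^ i) ^ d := by
    rw [← pow_mul, mul_comm, pow_mul, ← he, ← pow_mul, ← pow_mul, mul_comm]
  rw [h2]
  refine Eq.trans (Finset.prod_congr rfl fun h _ => ?_) (h1.trans ?_)
  · rw [pow_add θ, pow_mul θ, hθ, one_pow, mul_one, pow_add, pow_mul]
    simp only [map_mul, map_pow]
    ring
  · simp only [mul_pow, map_mul, map_pow]

theorem coeff_prod_one_sub {R ι : Type*} [CommRing R] (s : Finset ι) (c : ι → R) {d : ℕ}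
    (hd : 0 < d) (k : ℕ) :
    (∏ i ∈ s, (1 - Polynomial.C (c i) * Polynomial.X ^ d)).coeff (d * k) =
      (-1) ^ k * ∑ t ∈ Finset.powersetCard k s, ∏ i ∈ t, c i := by
  have h1 : ∀ t : Finset ι, ∏ i ∈ t, (-(Polynomial.C (c i) * Polynomial.X ^ d)) =
      Polynomial.C ((-1) ^ t.card * ∏ i ∈ t, c i) * Polynomial.X ^ (d * t.card) := by
    intro t
    rw [Finset.prod_neg, Finset.prod_mul_distrib, Finset.prod_const, ← pow_mul]
    simp only [map_mul, map_pow, map_neg, map_one, map_prod]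
    ring
  simp only [sub_eq_add_neg]
  rw [Finset.prod_one_add, Polynomial.finsetSum_coeff, Finset.powersetCard_eq_filter,
    Finset.sum_filter, Finset.mul_sum]
  refine Finset.sum_congr rfl fun t _ => ?_
  rw [h1, Polynomial.coeff_C_mul_X_pow]
  by_cases ht : t.card = k
  · simp [ht]
  · have : d * k ≠ d * t.card := fun h => ht (Nat.eq_of_mul_eq_mul_left hd h).symm
    simp [ht, this]

theorem sum_powersetCard_univ_fin {M : Type*} [AddCommMonoid M] (m k : ℕ)
    (f : Finset (Fin m) → M) :
    ∑ t ∈ Finset.powersetCard k Finset.univ, f t =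
      ∑ T : Fin k ↪o Fin m, f (Finset.univ.map T.toEmbedding) := by
  symm
  refine Finset.sum_nbij (fun T : Fin k ↪o Fin m => Finset.univ.map T.toEmbedding)
    (fun T _ => ?_) (fun T _ T' _ h => ?_) (fun t ht => ?_) (fun _ _ => rfl)
  · simp [Finset.mem_powersetCard]
  · have hr : Set.range T = Set.range T' := by
      have := congrArg (fun s : Finset (Fin m) => (s : Set (Fin m))) h
      simpa using this
    exact DFunLike.coe_injective ((StrictMono.range_inj T.strictMono T'.strictMono).1 hr)
  · have hc := (Finset.mem_powersetCard.1 (Finset.mem_coe.1 ht)).2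
    exact ⟨t.orderEmbOfFin hc, by simp, Finset.map_orderEmbOfFin_univ t hc⟩

/-- Rescaling the nodes by `η`. -/
theorem pow_mul_coeff_prod_nodes {m k : ℕ} (η θ : ℂ) (d e s : ℕ) (T : Fin k ↪o Fin m) :
    η ^ (s + k * e) * (∏ t, (Polynomial.C ((θ ^ (T t : ℕ)) ^ e) *
        (1 + Polynomial.C (θ ^ (T t : ℕ)) * Polynomial.X) ^ d)).coeff s =
      (∏ t, rootNodes m η θ (T t) ^ e) * (nodePoly (rootNodes m η θ) T ^ d).coeff s := by
  have h1 : nodePoly (rootNodes m η θ) T =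
      (∏ t, (1 + Polynomial.C (θ ^ (T t : ℕ)) * Polynomial.X)).comp
        (Polynomial.C η * Polynomial.X) := by
    rw [nodePoly, Polynomial.prod_comp]
    refine Finset.prod_congr rfl fun t _ => ?_
    simp only [rootNodes, Polynomial.add_comp, Polynomial.one_comp, Polynomial.mul_comp,
      Polynomial.C_comp, Polynomial.X_comp, map_mul]
    ring
  rw [h1, ← Polynomial.pow_comp, Polynomial.comp_C_mul_X_coeff, Finset.prod_mul_distrib,
    Finset.prod_pow, ← map_prod, Polynomial.coeff_C_mul]
  simp only [rootNodes, mul_pow, Finset.prod_mul_distrib, Finset.prod_const, Finset.card_univ,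
    Fintype.card_fin, pow_add]
  rw [← pow_mul, mul_comm e k]
  ring

theorem degreeHom_Phi {p m d e : ℕ} (hd : 0 < d) (hp : p = m * d) {q₁ q₂ : ℤ} {ω : ℂ}
    (hω : ω ^ p = 1) (hω0 : ω ≠ 0)
    (hα : IsPrimitiveRoot ((ω ^ q₁) ^ m) d) (hθ : (ω ^ (q₂ - q₁)) ^ m = 1)
    (he : (ω ^ q₁) ^ d = (ω ^ (q₂ - q₁)) ^ e) :
    degreeHom (Phi p q₁ q₂ ω) = 1 - ∏ i : Fin m,
      (1 - Polynomial.C (Polynomial.C (((ω ^ (q₂ - q₁)) ^ (i : ℕ)) ^ e) *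
        (1 + Polynomial.C ((ω ^ (q₂ - q₁)) ^ (i : ℕ)) * Polynomial.X) ^ d) *
          Polynomial.X ^ d) := by
  rw [← prod_collapse hd hα hθ he, Phi, map_sub, map_one, map_prod, ← hp]
  congr 1
  have hper : ∀ q : ℤ, (ω ^ q) ^ p = 1 := fun q => by
    rw [← zpow_natCast, ← zpow_mul, mul_comm, zpow_mul, zpow_natCast, hω, one_zpow]
  rw [← Finset.prod_Icc_one_eq_prod_range (by simp only [hper, pow_zero])]
  refine Finset.prod_congr rfl fun j _ => ?_
  have hC : ∀ a : ℂ, degreeHom (C a) = Polynomial.C (Polynomial.C a) := fun a => by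
    rw [degreeHom, aeval_C]
    rfl
  have h1 : ω ^ (q₂ * (j : ℤ)) = (ω ^ q₁) ^ j * (ω ^ (q₂ - q₁)) ^ j := by
    rw [← mul_pow, ← zpow_add₀ hω0, ← zpow_natCast, ← zpow_mul]
    congr 2
    ring
  rw [h1, zpow_mul, zpow_natCast, map_sub, map_sub, map_one, map_mul, map_mul, hC, hC, degreeHom,
    aeval_X, aeval_X]
  simp only [Matrix.cons_val_zero, Matrix.cons_val_one, map_mul, map_add, map_one]
  ring

/-- On the support, the coefficient is a signed natural number. -/
theorem exists_phiCoeff_eq {p m d e : ℕ} (hd : 0 < d) (hm : m ≠ 0) (hp : p = m * d) {q₁ q₂ : ℤ}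
    {ω : ℂ} (hω : ω ^ p = 1) (hω0 : ω ≠ 0) (hα : IsPrimitiveRoot ((ω ^ q₁) ^ m) d)
    (hθ : IsPrimitiveRoot (ω ^ (q₂ - q₁)) m) (he : (ω ^ q₁) ^ d = (ω ^ (q₂ - q₁)) ^ e)
    {r s n w : ℕ} (hrs : r + s = d * (n + 1)) (hw : s + (n + 1) * e = m * w) :
    ∃ N : ℕ, phiCoeff p q₁ q₂ ω r s = (-1) ^ (n * (w + 1)) * (N : ℂ) ∧ (N ≠ 0 ↔ r + s ≤ p) := by
  set θ := ω ^ (q₂ - q₁) with hθdef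
  -- The value (-1)^n is the one for which rotating n + 1 particles costs no sign.
  obtain ⟨η, hη⟩ := IsAlgClosed.exists_pow_nat_eq ((-1 : ℂ) ^ n) (Nat.pos_of_ne_zero hm)
  obtain ⟨N, hN, hpos⟩ := exists_nat_sum_coeff hd hm hθ hη e s
  have hle : r + s ≤ p ↔ n + 1 ≤ m := by
    rw [hrs, hp, mul_comm m d]
    exact Nat.mul_le_mul_left_iff hd
  refine ⟨N, ?_, ?_⟩
  · rw [phiCoeff, ← coeff_degreeHom, degreeHom_Phi hd hp hω hω0 hα hθ.pow_eq_one he, hrs,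
      Polynomial.coeff_sub, coeff_prod_one_sub _ _ hd, sum_powersetCard_univ_fin,
      Polynomial.coeff_one, if_neg (by positivity)]
    have h1 : η ^ (s + (n + 1) * e) * (∑ T : Fin (n + 1) ↪o Fin m,
        ∏ i ∈ Finset.univ.map T.toEmbedding, Polynomial.C ((θ ^ (i : ℕ)) ^ e) *
        (1 + Polynomial.C (θ ^ (i : ℕ)) * Polynomial.X) ^ d).coeff s = N := by
      rw [← hN, Polynomial.finsetSum_coeff, Finset.mul_sum]
      refine Finset.sum_congr rfl fun T _ => ?_
      rw [Finset.prod_map, ← pow_mul_coeff_prod_nodes]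
      rfl
    rw [hw, pow_mul, hη, ← pow_mul] at h1
    have h2 : ((-1 : Polynomial ℂ)) ^ (n + 1) = Polynomial.C ((-1) ^ (n + 1)) := by simp
    rw [h2, zero_sub, Polynomial.coeff_neg, Polynomial.coeff_C_mul, ← h1]
    -- The rescaling contributes η^(mw) = (-1)^(nw), and 1 - ∏ contributes -(-1)^(n + 1) = (-1)^n.
    have h3 : ((-1 : ℂ)) ^ (n * (w + 1)) * (-1) ^ (n * w) = (-1) ^ n := by
      rw [mul_add, pow_add, mul_right_comm, ← pow_add, ← two_mul, pow_mul]
      simp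
    rw [← mul_assoc, h3, pow_succ]
    ring
  · rw [hle]
    refine ⟨fun h => ?_, fun h => hpos h (by rw [mul_comm]; omega) ⟨w, hw⟩⟩
    by_contra hcon
    apply h
    have : IsEmpty (Fin (n + 1) ↪o Fin m) := by
      refine ⟨fun T => hcon ?_⟩
      simpa using Fintype.card_le_of_injective T T.injective
    have h0 : (N : ℂ) = 0 := by rw [← hN]; simp
    exact_mod_cast h0

/-! ### Parity of the sign and the arithmetic data. -/

/-- Two descriptions of when the homology class of a configuration is divisible by two. -/
theorem odd_gcd_iff_even_mul {p m d e r s n w : ℕ} {q₁ q₂ l c f : ℤ} (hd : d ≠ 0) (hm : m ≠ 0)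
    (hp : p = m * d) (hgcd : Nat.gcd p (Int.gcd q₁ q₂) = 1) (hc : q₂ - q₁ = d * c)
    (hf : q₁ = e * c + m * f) (hrs : r + s = d * (n + 1)) (hw : s + (n + 1) * e = m * w)
    (hl : (r : ℤ) * q₁ + (s : ℤ) * q₂ = l * (p : ℤ)) :
    Odd (Nat.gcd (Nat.gcd r s) l.natAbs) ↔ Even (n * (w + 1)) := by
  have hd' : (d : ℤ) ≠ 0 := Nat.cast_ne_zero.2 hd
  have hm' : (m : ℤ) ≠ 0 := Nat.cast_ne_zero.2 hm
  have hrs' : (r : ℤ) + s = d * (n + 1) := by exact_mod_cast hrs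
  have hw' : (s : ℤ) + (n + 1) * e = m * w := by exact_mod_cast hw
  have hp' : (p : ℤ) = m * d := by exact_mod_cast hp
  have hl1 : l = w * c + (n + 1) * f := by
    apply mul_right_cancel₀ (mul_ne_zero hm' hd')
    rw [← hp', ← hl]
    have : q₂ = q₁ + d * c := by linarith
    rw [this, show (s : ℤ) = m * w - (n + 1) * e by linarith,
      show (r : ℤ) = d * (n + 1) - (m * w - (n + 1) * e) by linarith, hf, hp']
    ring
  -- The multiples of n + 1 and w by q₁, dc = q₂ - q₁ and p are integral combinations of r, s, l.
  -- These three multipliers have no common factor 2, so they can be cancelled mod 2.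
  have hcancel : ∀ x : ℤ, (2 : ℤ) ∣ x * q₁ → (2 : ℤ) ∣ x * (d * c) → (2 : ℤ) ∣ x * p →
      (2 : ℤ) ∣ x := by
    intro x h1 h2 h3
    by_contra hx
    have hpr : Prime (2 : ℤ) := Int.prime_two
    have a1 := (hpr.dvd_or_dvd h1).resolve_left hx
    have a2 := (hpr.dvd_or_dvd h2).resolve_left hx
    have a3 := (hpr.dvd_or_dvd h3).resolve_left hx
    have a4 : (2 : ℤ) ∣ q₂ := by
      have : q₂ = q₁ + d * c := by linarith
      rw [this]
      exact dvd_add a1 a2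
    have a5 : 2 ∣ Nat.gcd p (Int.gcd q₁ q₂) :=
      Nat.dvd_gcd (by exact_mod_cast a3) (Int.dvd_gcd a1 a4)
    rw [hgcd] at a5
    norm_num at a5
  have key : (2 ∣ Nat.gcd (Nat.gcd r s) l.natAbs) ↔ ((2 : ℤ) ∣ (n + 1) ∧ (2 : ℤ) ∣ w) := by
    rw [Nat.dvd_gcd_iff, Nat.dvd_gcd_iff, ← Int.natCast_dvd_natCast, ← Int.natCast_dvd_natCast,
      ← Int.natCast_dvd]
    push_cast
    constructor
    · rintro ⟨⟨⟨a, ha⟩, ⟨b, hb⟩⟩, ⟨g, hg⟩⟩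
      constructor
      · refine hcancel _ ⟨m * g - b * c, ?_⟩ ⟨c * (a + b), ?_⟩ ⟨m * (a + b), ?_⟩
        · rw [mul_sub, ← mul_assoc, ← mul_assoc, mul_comm 2, mul_assoc, ← hg, ← hb, hl1, hf,
            show (s : ℤ) = m * w - (n + 1) * e by linarith]
          ring
        · have : (n + 1 : ℤ) * (d * c) = (r + s) * c := by rw [hrs']; ring
          rw [this, ha, hb]; ring
        · have : (n + 1 : ℤ) * p = m * (r + s) := by rw [hrs', hp']; ring
          rw [this, ha, hb]; ring
      · refine hcancel _ ⟨e * g + f * b, ?_⟩ ⟨d * g - f * (a + b), ?_⟩ ⟨d * b + e * (a + b), ?_⟩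
        · have : (w : ℤ) * q₁ = e * l + f * s := by
            rw [hl1, hf, show (s : ℤ) = m * w - (n + 1) * e by linarith]; ring
          rw [this, hg, hb]; ring
        · have : (w : ℤ) * (d * c) = d * l - f * (r + s) := by rw [hl1, hrs']; ring
          rw [this, hg, ha, hb]; ring
        · have : (w : ℤ) * p = d * s + e * (r + s) := by
            rw [hrs', hp', show (s : ℤ) = m * w - (n + 1) * e by linarith]; ring
          rw [this, ha, hb]; ring
    · rintro ⟨⟨a, ha⟩, ⟨b, hb⟩⟩
      have h1 : (s : ℤ) = 2 * (m * b - a * e) := by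
        rw [show (s : ℤ) = m * w - (n + 1) * e by linarith, ha, hb]; ring
      refine ⟨⟨⟨d * a - (m * b - a * e), ?_⟩, ⟨_, h1⟩⟩, ⟨b * c + a * f, ?_⟩⟩
      · rw [show (r : ℤ) = d * (n + 1) - s by linarith, h1, ha]; ring
      · rw [hl1, ha, hb]; ring
  rw [← Nat.not_even_iff_odd, even_iff_two_dvd, key, Nat.even_mul, Nat.even_iff, Nat.even_iff]
  -- n(w + 1) is odd exactly when n + 1 and w are both even.
  omega

/-- The data of the torus: `d` rows of length `m`, glued with a shift by `e`. -/
theorem exists_torus_data {p : ℕ} (hp : 1 ≤ p) {q₁ q₂ : ℤ}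
    (hgcd : Nat.gcd p (Int.gcd q₁ q₂) = 1) {ω : ℂ} (hω : IsPrimitiveRoot ω p) :
    ∃ (m d e : ℕ) (c f : ℤ), d ≠ 0 ∧ m ≠ 0 ∧ p = m * d ∧ q₂ - q₁ = d * c ∧
      q₁ = e * c + m * f ∧ IsCoprime q₁ d ∧ IsPrimitiveRoot ((ω ^ q₁) ^ m) d ∧
      IsPrimitiveRoot (ω ^ (q₂ - q₁)) m ∧ (ω ^ q₁) ^ d = (ω ^ (q₂ - q₁)) ^ e := by
  have hω0 : ω ≠ 0 := hω.ne_zero (by omega)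
  have hpZ : (p : ℤ) ≠ 0 := Nat.cast_ne_zero.2 (by omega)
  set d := Int.gcd (q₂ - q₁) p with hd
  have hdpos : 0 < d := Int.gcd_pos_of_ne_zero_right _ hpZ
  obtain ⟨c, hc⟩ : (d : ℤ) ∣ q₂ - q₁ := Int.gcd_dvd_left ..
  have hdp : (d : ℤ) ∣ p := Int.gcd_dvd_right ..
  obtain ⟨m, hm⟩ : d ∣ p := Int.natCast_dvd_natCast.1 hdp
  have hm0 : m ≠ 0 := by
    rintro rfl
    omega
  have hdZ : (d : ℤ) ≠ 0 := Nat.cast_ne_zero.2 hdpos.ne'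
  have hcm : Int.gcd c m = 1 := by
    have h := Int.gcd_div_gcd_div_gcd (i := q₂ - q₁) (j := p) hdpos
    rw [← hd, hc, hm, Nat.cast_mul, Int.mul_ediv_cancel_left _ hdZ,
      Int.mul_ediv_cancel_left _ hdZ] at h
    exact h
  have hqd : Int.gcd q₁ d = 1 := by
    have h1 : ((Int.gcd q₁ d : ℕ) : ℤ) ∣ q₁ := Int.gcd_dvd_left ..
    have h2 : ((Int.gcd q₁ d : ℕ) : ℤ) ∣ d := Int.gcd_dvd_right ..
    have h3 : ((Int.gcd q₁ d : ℕ) : ℤ) ∣ q₂ := by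
      have : q₂ = q₁ + d * c := by linarith
      rw [this]
      exact dvd_add h1 (h2.mul_right c)
    have h4 : Int.gcd q₁ d ∣ Nat.gcd p (Int.gcd q₁ q₂) :=
      Nat.dvd_gcd (Int.natCast_dvd_natCast.1 (h2.trans hdp)) (Int.dvd_gcd h1 h3)
    rw [hgcd] at h4
    exact Nat.dvd_one.1 h4
  have hα : IsPrimitiveRoot ((ω ^ q₁) ^ m) d := by
    have h := (hω.pow (a := m) (b := d) (by omega) (by rw [hm, mul_comm])).zpow_of_gcd_eq_one q₁ hqd
    rwa [← zpow_natCast, ← zpow_mul, mul_comm, zpow_mul, zpow_natCast] at h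
  have hθ : IsPrimitiveRoot (ω ^ (q₂ - q₁)) m := by
    have h := (hω.pow (a := d) (b := m) (by omega) hm).zpow_of_gcd_eq_one c hcm
    rwa [← zpow_natCast, ← zpow_mul, ← hc] at h
  have : NeZero m := ⟨hm0⟩
  -- The m-th power of (ω^q₁)^d is ω^(q₁p) = 1, so it is a power of the primitive root θ. Lifting
  -- this to exponents of ω and dividing by d gives `f`.
  obtain ⟨e, -, he⟩ := hθ.eq_pow_of_pow_eq_one (ξ := (ω ^ q₁) ^ d) (by
    rw [← pow_mul, ← hm, ← zpow_natCast, ← zpow_mul, mul_comm, zpow_mul, zpow_natCast,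
      hω.pow_eq_one, one_zpow])
  have hdiv : (p : ℤ) ∣ q₁ * d - (q₂ - q₁) * e := by
    rw [← hω.zpow_eq_one_iff_dvd, zpow_sub₀ hω0, zpow_mul, zpow_mul, zpow_natCast, zpow_natCast, he,
      div_self]
    exact pow_ne_zero _ (zpow_ne_zero _ hω0)
  obtain ⟨f, hf⟩ := hdiv
  refine ⟨m, d, e, c, f, hdpos.ne', hm0, by rw [hm, mul_comm], hc, ?_,
    Int.isCoprime_iff_gcd_eq_one.2 hqd, hα, hθ, he.symm⟩
  apply mul_left_cancel₀ hdZ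
  rw [hc, hm] at hf
  push_cast at hf
  linarith

/-- The coefficients on the support, with their signs. -/
theorem exists_phiCoeff_eq_sign {p : ℕ} (hp : 1 ≤ p) {q₁ q₂ : ℤ}
    (hgcd : Nat.gcd p (Int.gcd q₁ q₂) = 1) {ω : ℂ} (hω : IsPrimitiveRoot ω p) {r s : ℕ} {l : ℤ}
    (hrs : 1 ≤ r + s) (hl : (r : ℤ) * q₁ + (s : ℤ) * q₂ = l * (p : ℤ)) :
    ∃ N a : ℕ, phiCoeff p q₁ q₂ ω r s = (-1) ^ a * (N : ℂ) ∧ (N ≠ 0 ↔ r + s ≤ p) ∧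
      (Odd (Nat.gcd (Nat.gcd r s) l.natAbs) ↔ Even a) := by
  have hω0 : ω ≠ 0 := hω.ne_zero (by omega)
  obtain ⟨m, d, e, c, f, hd, hm, hpm, hc, hf, hcop, hα, hθ, he⟩ := exists_torus_data hp hgcd hω
  have hpm' : (p : ℤ) = m * d := by exact_mod_cast hpm
  have hq₂ : q₂ = q₁ + d * c := by linarith
  have h1 : ((r : ℤ) + s) * q₁ = d * (l * m - s * c) := by
    rw [hq₂, hpm'] at hl
    linarith
  have h2 : d ∣ r + s := by
    have : (d : ℤ) ∣ (r : ℤ) + s := hcop.symm.dvd_of_dvd_mul_right ⟨_, h1⟩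
    exact_mod_cast this
  obtain ⟨k, hk⟩ := h2
  obtain ⟨n, rfl⟩ : ∃ n, k = n + 1 :=
    Nat.exists_eq_succ_of_ne_zero (by rintro rfl; omega)
  -- θ^(s + (n + 1)e) = θ^s (ω^q₁)^(r + s) = ω^(rq₁ + sq₂) = 1.
  have h3 : m ∣ s + (n + 1) * e := by
    rw [← hθ.pow_eq_one_iff_dvd, pow_add, mul_comm (n + 1) e, pow_mul, ← he, ← pow_mul, ← hk,
      ← zpow_natCast, ← zpow_natCast, ← zpow_mul, ← zpow_mul, ← zpow_add₀ hω0,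
      hω.zpow_eq_one_iff_dvd]
    refine ⟨l, ?_⟩
    push_cast
    linarith
  obtain ⟨w, hw⟩ := h3
  obtain ⟨N, hN, hN0⟩ := exists_phiCoeff_eq (Nat.pos_of_ne_zero hd) hm hpm hω.pow_eq_one hω0 hα hθ
    he hk hw
  exact ⟨N, n * (w + 1), hN, hN0, odd_gcd_iff_even_mul hd hm hpm hgcd hc hf hk hw hl⟩

/-! ### Vanishing off the support and the final assembly. -/

theorem phiCoeff_zero_zero (p : ℕ) (q₁ q₂ : ℤ) (ω : ℂ) : phiCoeff p q₁ q₂ ω 0 0 = 0 := by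
  have : (Finsupp.single (0 : Fin 2) 0 + Finsupp.single (1 : Fin 2) 0) = 0 := by simp
  rw [phiCoeff, this, ← constantCoeff_eq, Phi]
  simp

theorem phiCoeff_eq_zero_of_not_dvd {p : ℕ} (hp : 1 ≤ p) {q₁ q₂ : ℤ} {ω : ℂ}
    (hω : IsPrimitiveRoot ω p) {r s : ℕ} (h : ¬ (p : ℤ) ∣ (r : ℤ) * q₁ + (s : ℤ) * q₂) :
    phiCoeff p q₁ q₂ ω r s = 0 := by
  have h1 := phiCoeff_mul_zpow (q₁ := q₁) (q₂ := q₂) hω.pow_eq_one (hω.ne_zero (by omega)) r s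
  by_contra hne
  exact h ((hω.zpow_eq_one_iff_dvd _).1 (mul_eq_right₀ hne |>.1 h1))

theorem theorem2 (p : ℕ) (hp : 1 ≤ p) (q₁ q₂ : ℤ)
    (hgcd : Nat.gcd p (Int.gcd q₁ q₂) = 1) (ω : ℂ) (hω : IsPrimitiveRoot ω p) :
    -- every coefficient is real
    (∀ r s : ℕ, (phiCoeff p q₁ q₂ ω r s).im = 0) ∧
    -- the monomials that occur
    (∀ r s : ℕ, phiCoeff p q₁ q₂ ω r s ≠ 0 ↔
      (1 ≤ r + s ∧ r + s ≤ p ∧ (p : ℤ) ∣ (r : ℤ) * q₁ + (s : ℤ) * q₂)) ∧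
    -- the signs of their coefficients, where `l = (r q₁ + s q₂) / p`
    (∀ (r s : ℕ) (l : ℤ), 1 ≤ r + s → r + s ≤ p →
      (r : ℤ) * q₁ + (s : ℤ) * q₂ = l * (p : ℤ) →
      (0 < (phiCoeff p q₁ q₂ ω r s).re ↔ Odd (Nat.gcd (Nat.gcd r s) l.natAbs))) := by
  have hreal : ∀ a N : ℕ, ((-1 : ℂ) ^ a * (N : ℂ)) = (((-1 : ℝ) ^ a * (N : ℝ) : ℝ) : ℂ) := by
    intro a N
    push_cast
    rfl
  refine ⟨fun r s => ?_, fun r s => ?_, fun r s l hrs hle hl => ?_⟩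
  · rcases Nat.eq_zero_or_pos (r + s) with h0 | h0
    · obtain ⟨rfl, rfl⟩ : r = 0 ∧ s = 0 := by omega
      simp [phiCoeff_zero_zero]
    by_cases h : (p : ℤ) ∣ (r : ℤ) * q₁ + (s : ℤ) * q₂
    · obtain ⟨l, hl⟩ := h
      obtain ⟨N, a, hN, -, -⟩ := exists_phiCoeff_eq_sign hp hgcd hω h0 (hl.trans (mul_comm _ _))
      rw [hN, hreal, Complex.ofReal_im]
    · simp [phiCoeff_eq_zero_of_not_dvd hp hω h]
  · rcases Nat.eq_zero_or_pos (r + s) with h0 | h0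
    · obtain ⟨rfl, rfl⟩ : r = 0 ∧ s = 0 := by omega
      simp [phiCoeff_zero_zero]
    by_cases h : (p : ℤ) ∣ (r : ℤ) * q₁ + (s : ℤ) * q₂
    · obtain ⟨l, hl⟩ := id h
      obtain ⟨N, a, hN, hN0, -⟩ := exists_phiCoeff_eq_sign hp hgcd hω h0 (hl.trans (mul_comm _ _))
      have : phiCoeff p q₁ q₂ ω r s ≠ 0 ↔ N ≠ 0 := by
        rw [hN]
        simp
      rw [this, hN0]
      exact ⟨fun hle => ⟨h0, hle, h⟩, fun hh => hh.2.1⟩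
    · simp [phiCoeff_eq_zero_of_not_dvd hp hω h, h]
  · obtain ⟨N, a, hN, hN0, hodd⟩ := exists_phiCoeff_eq_sign hp hgcd hω hrs hl
    have hpos : (0 : ℝ) < N := Nat.cast_pos.2 (Nat.pos_of_ne_zero (hN0.2 hle))
    rw [hN, hreal, Complex.ofReal_re, hodd]
    rcases Nat.even_or_odd a with ha | ha
    · simp [ha.neg_one_pow, ha, hpos]
    · rw [ha.neg_one_pow]
      have : ¬ Even a := Nat.not_even_iff_odd.2 ha
      simp only [this, iff_false, not_lt]
      linarith
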